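/- For a finite set $S$ let $\Delta_S$ be the set of probability distributions on $S$. Let $\mathcal X,\mathcal Y$ be finite sets, $P_{\mathcal X}:\mathcal X\to\Delta_{\mathcal X}$ and $P_{\mathcal Y}:\mathcal Y\to\Delta_{\mathcal Y}$ transition functions, $x_0\in\mathcal X$, $y_0\in\mathcal Y$, $c:\mathcal X\times\mathcal Y\to[0,\infty)$ and $\gamma\in(0,1)$. Let $M_{\mathcal X}$ and $M_{\mathcal Y}$ be the laws, on $\mathcal X^{\mathbb N}$ and $\mathcal Y^{\mathbb N}$ (times $t=0,1,2,\dots$), of the Markov chains with these transition functions started at $x_0$ and $y_0$. A coupling of $M_{\mathcal X}$ and $M_{\mathcal Y}$ is a probability measure $M$ on $(\mathcal X\times\mathcal Y)^{\mathbb N}$ whose marginals on $\mathcal X^{\mathbb N}$ and $\mathcal Y^{\mathbb N}$ are $M_{\mathcal X}$ and $M_{\mathcal Y}$. Write $\bar x_n\in\mathcal X^{n+1}$, $\bar y_n\in\mathcal Y^{n+1}$ for values of $(X_0,\dots,X_n)$, $(Y_0,\dots,Y_n)$, and $\mid\bar x_n$, $\mid\bar x_n,\bar y_n$ for conditioning on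 these values. A coupling $M$ is called bicausal if $$\sum_{y'}M(X_{n+1}=x',Y_{n+1}=y'\mid \bar x_n,\bar y_n)=M_{\mathcal X}(X_{n+1}=x'\mid\bar x_n),\qquad \sum_{x'}M(X_{n+1}=x',Y_{n+1}=y'\mid \bar x_n,\bar y_n)=M_{\mathcal Y}(Y_{n+1}=y'\mid\bar y_n)$$ for all $n\ge 0$, all $x'\in\mathcal X$, $y'\in\mathcal Y$, and all histories $(\bar x_n,\bar y_n)$ of positive probability under $M$. Let $\Pi_{\mathrm{bc}}$ be the set of bicausal couplings and $$\mathbb W_\gamma(M_{\mathcal X},M_{\mathcal Y};c,x_0,y_0)=\inf_{M\in\Pi_{\mathrm{bc}}}\int\sum_{t=0}^\infty\gamma^t c(X_t,Y_t)\,dM .$$ Let $\mathcal B$, $\mathcal S_{\mathcal X}$, $\mathcal S_{\mathcal Y}$ be the sets of distributions $\mu\in\Delta_{(\mathcal X\times\mathcal Y)\times(\mathcal X\times\mathcal Y)}$ that satisfy, respectively, for all $x,x'\in\mathcal X$ and $y,y'\in\mathcal Y$, $$\sum_{x'',y''}\mu(xy,x''y'')=\gamma\sum_{x'',y''}\mu(x''y'',xy)+(1-\gamma)\,\mathbf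 1\{(x,y)=(x_0,y_0)\},$$ $$\sum_{y''}\mu(xy,x'y'')=P_{\mathcal X}(x'\mid x)\sum_{x'',y''}\mu(xy,x''y''),\qquad \sum_{x''}\mu(xy,x''y')=P_{\mathcal Y}(y'\mid y)\sum_{x'',y''}\mu(xy,x''y'').$$ Let $\langle\mu,c\rangle=\sum_{xy,x'y'}\mu(xy,x'y')\,c(x,y)$. Then $\Pi_{\mathrm{bc}}$ is non-empty, the discounted cost is integrable under each of its elements, the infimum of $\langle\mu,c\rangle$ over $\mathcal B\cap\mathcal S_{\mathcal X}\cap\mathcal S_{\mathcal Y}$ is attained, and $$\mathbb W_\gamma(M_{\mathcal X},M_{\mathcal Y};c,x_0,y_0)=\frac1{1-\gamma}\,\inf_{\mu\in\mathcal B\cap\mathcal S_{\mathcal X}\cap\mathcal S_{\mathcal Y}}\langle\mu,c\rangle ,$$ so the distance is the value, up to the factor $1/(1-\gamma)$, of a finite linear program. -/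

import Mathlib

open MeasureTheory ProbabilityTheory

noncomputable section

namespace MarkovOT

/-! ### Laws of finite Markov chains

The set `Δ_S` of probability distributions on a finite set `S` is `stdSimplex ℝ S`. -/

section Law

variable {S : Type*} [Fintype S] [MeasurableSpace S] [DiscreteMeasurableSpace S]

/-- A transition function `P : S → Δ_S` as a kernel: from `s` it moves to `s'` with
probability `P s s'`. -/
def stepKernel (P : S → stdSimplex ℝ S) : Kernel S S where
  toFun s := ∑ s', ENNReal.ofReal (P s s') • Measure.dirac s'
  measurable' := Measurable.of_discrete

instance (P : S → stdSimplex ℝ S) : IsMarkovKernel (stepKernel P) where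
  isProbabilityMeasure s := by
    constructor
    have h : ∑ s', ENNReal.ofReal (P s s') = 1 := by
      have h0 : ∀ i ∈ Finset.univ, 0 ≤ P s i := fun i _ => (P s).2.1 i
      have h1 : ∑ i, P s i = 1 := (P s).2.2
      rw [← ENNReal.ofReal_sum_of_nonneg h0, h1, ENNReal.ofReal_one]
    simpa [stepKernel, Measure.finsetSum_apply] using h

/-- The law on `S^ℕ` of the trajectory `(S_0, S_1, …)` of the Markov chain with transition
function `P` and initial state `s₀`: given `(S_0, …, S_n)`, the next state `S_{n+1}` has
distribution `P S_n`. -/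
def chainLaw (P : S → stdSimplex ℝ S) (s₀ : S) : Measure (ℕ → S) :=
  Kernel.trajMeasure (X := fun _ : ℕ => S) (Measure.dirac s₀)
    (fun n => (stepKernel P).comap
      (fun h : (i : Finset.Iic n) → S => h ⟨n, Finset.mem_Iic.2 le_rfl⟩) (by fun_prop))

/-- The event that the trajectory agrees with `s` at the times `0, …, n`. -/
def history (s : ℕ → S) (n : ℕ) : Set (ℕ → S) := {ω | ∀ t ≤ n, ω t = s t}

/-- The conditional probability, under `M`, that the state at time `n + 1` is `s'` given that the
states at the times `0, …, n` are `s 0, …, s n`. -/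
def nextProb (M : Measure (ℕ → S)) (s : ℕ → S) (n : ℕ) (s' : S) : ℝ :=
  (M[|history s n]).real {ω | ω (n + 1) = s'}

end Law

/-! ### Bicausal couplings and the optimal transport distance -/

section Distance

variable {X Y : Type*} [Fintype X] [MeasurableSpace X] [DiscreteMeasurableSpace X]
  [Fintype Y] [MeasurableSpace Y] [DiscreteMeasurableSpace Y]

/-- `M` is a coupling of the two laws `MX` and `MY`: a law of a process on `X × Y` with
marginals `MX` and `MY`. -/
def IsCoupling (MX : Measure (ℕ → X)) (MY : Measure (ℕ → Y)) (M : Measure (ℕ → X × Y)) : Prop :=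
  M.map (fun ω t => (ω t).1) = MX ∧ M.map (fun ω t => (ω t).2) = MY

/-- Bicausality: given a joint history, the next `X`-state has the conditional distribution that
it has under `MX` given the `X`-history alone, and symmetrically for `Y`. The conditional
probabilities only make sense for histories of positive probability. -/
def IsBicausal (MX : Measure (ℕ → X)) (MY : Measure (ℕ → Y)) (M : Measure (ℕ → X × Y)) : Prop :=
  ∀ (n : ℕ) (x : ℕ → X) (y : ℕ → Y), M (history (fun t => (x t, y t)) n) ≠ 0 →
    (∀ x', ∑ y', nextProb M (fun t => (x t, y t)) n (x', y') = nextProb MX x n x') ∧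
    (∀ y', ∑ x', nextProb M (fun t => (x t, y t)) n (x', y') = nextProb MY y n y')

/-- The set of all bicausal couplings of the two Markov chains. -/
def bicausalCouplings (PX : X → stdSimplex ℝ X) (PY : Y → stdSimplex ℝ Y) (x₀ : X) (y₀ : Y) :
    Set (Measure (ℕ → X × Y)) :=
  {M | IsProbabilityMeasure M ∧ IsCoupling (chainLaw PX x₀) (chainLaw PY y₀) M ∧
    IsBicausal (chainLaw PX x₀) (chainLaw PY y₀) M}

/-- The discounted total cost of a pair of trajectories. -/
def discountedCost (γ : ℝ) (c : X × Y → ℝ) (ω : ℕ → X × Y) : ℝ := ∑' t, γ ^ t * c (ω t)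

/-- The optimal transport distance between the two Markov chains. -/
def otDist (γ : ℝ) (PX : X → stdSimplex ℝ X) (PY : Y → stdSimplex ℝ Y) (c : X × Y → ℝ)
    (x₀ : X) (y₀ : Y) : ℝ :=
  sInf ((fun M => ∫ ω, discountedCost γ c ω ∂M) '' bicausalCouplings PX PY x₀ y₀)

end Distance

/-! ### The linear program -/

section LP

variable {X Y : Type*} [Fintype X] [Fintype Y]

open Classical in
/-- The distributions `μ` on `XY × XY` that satisfy the flow constraint with initial
distribution `δ_{(x₀, y₀)}`. -/
def flowSet (γ : ℝ) (x₀ : X) (y₀ : Y) : Set ((X × Y) × (X × Y) → ℝ) :=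
  {μ | μ ∈ stdSimplex ℝ ((X × Y) × (X × Y)) ∧
    ∀ z : X × Y, ∑ z', μ (z, z') =
      γ * ∑ z', μ (z', z) + (1 - γ) * (if z = (x₀, y₀) then 1 else 0)}

/-- The distributions `μ` on `XY × XY` that satisfy the transition coherence constraint for
the chain on `X`. -/
def coherentX (PX : X → stdSimplex ℝ X) : Set ((X × Y) × (X × Y) → ℝ) :=
  {μ | μ ∈ stdSimplex ℝ ((X × Y) × (X × Y)) ∧
    ∀ (x : X) (y : Y) (x' : X), ∑ y', μ ((x, y), (x', y')) = (∑ z, μ ((x, y), z)) * PX x x'}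

/-- The distributions `μ` on `XY × XY` that satisfy the transition coherence constraint for
the chain on `Y`. -/
def coherentY (PY : Y → stdSimplex ℝ Y) : Set ((X × Y) × (X × Y) → ℝ) :=
  {μ | μ ∈ stdSimplex ℝ ((X × Y) × (X × Y)) ∧
    ∀ (x : X) (y : Y) (y' : Y), ∑ x', μ ((x, y), (x', y')) = (∑ z, μ ((x, y), z)) * PY y y'}

/-- The linear objective `⟨μ, c⟩`. -/
def lpCost (c : X × Y → ℝ) (μ : (X × Y) × (X × Y) → ℝ) : ℝ := ∑ z, ∑ z', μ (z, z') * c z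

end LP

end MarkovOT

end

open MarkovOT

open MarkovOT

/-! The expected cost of a process depends only on its discounted occupation measure of transitions,
μ(z, z') = (1 - γ) ∑ₜ γᵗ M(ωₜ = z, ωₜ₊₁ = z'), and does so linearly (`integral_discountedCost`). It
therefore suffices that the occupation measures of bicausal couplings are exactly the feasible
points of the linear program: the two sets of values then agree up to the factor, and so do their
infima.

Occupation measures are feasible (`occupation_mem`). Splitting off time 0 gives the flow constraint.
Bicausality makes the next `X`-state, given the joint history, follow `PX` from the current
`X`-state; this rule is the same for all histories and times, so it survives averaging over them.
The coupling itself need not be Markov.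

Conversely (`exists_occupation_eq`), a feasible μ disintegrates into its first marginal and a joint
transition function Q. Coherence says that Q has marginals `PX` and `PY`, so the chain driven by Q
is a bicausal coupling. Its occupation measure and μ share Q and the flow equation, which has at
most one solution because γQ contracts in ℓ¹ (`eq_of_flow`).

Attainment is compactness of the feasible set, and the independent coupling shows that nothing is
empty. -/

namespace MarkovOT

/-! ### Laws of finite Markov chains and their histories -/

section Law

open Preorder

lemma history_eq_preimage {S : Type*} (s : ℕ → S) (n : ℕ) :
    history s n = frestrictLe (π := fun _ : ℕ => S) n ⁻¹' {frestrictLe n s} := by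
  ext ω
  simp [history, funext_iff, frestrictLe]

lemma history_succ {S : Type*} (s : ℕ → S) (n : ℕ) :
    history s (n + 1) = history s n ∩ {ω | ω (n + 1) = s (n + 1)} := by
  ext ω
  simp only [history, Set.mem_ofPred_eq, Set.mem_inter_iff]
  refine ⟨fun h => ⟨fun t ht => h t (by omega), h _ le_rfl⟩, fun h t ht => ?_⟩
  rcases Nat.le_succ_iff.1 ht with ht | rfl
  exacts [h.1 t ht, h.2]

lemma measurable_comp_path {S Z : Type*} [MeasurableSpace S]
    [MeasurableSpace Z] [DiscreteMeasurableSpace Z] (π : Z → S) :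
    Measurable fun (ω : ℕ → Z) t => π (ω t) :=
  measurable_pi_lambda _ fun t => Measurable.of_discrete.comp (measurable_pi_apply t)

variable {S : Type*} [Fintype S] [MeasurableSpace S] [DiscreteMeasurableSpace S]

instance (P : S → stdSimplex ℝ S) (s₀ : S) : IsProbabilityMeasure (chainLaw P s₀) := by
  unfold chainLaw
  infer_instance

lemma stepKernel_real_singleton (P : S → stdSimplex ℝ S) (s s' : S) :
    (stepKernel P s).real {s'} = P s s' := by
  classical
  have h : stepKernel P s = ∑ s', ENNReal.ofReal (P s s') • Measure.dirac s' := rfl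
  rw [measureReal_def, h]
  simp only [Measure.finsetSum_apply, Measure.smul_apply, smul_eq_mul,
    Measure.dirac_apply' _ (MeasurableSet.singleton s'), Set.indicator_apply, Set.mem_singleton_iff,
    Pi.one_apply, mul_ite, mul_one, mul_zero, Finset.sum_ite_eq', Finset.mem_univ, if_true]
  exact ENNReal.toReal_ofReal ((P s).2.1 s')

lemma measurableSet_history (s : ℕ → S) (n : ℕ) : MeasurableSet (history s n) := by
  rw [history_eq_preimage]
  exact (measurable_frestrictLe n) (MeasurableSet.singleton _)

lemma chainLaw_real_zero [DecidableEq S] (P : S → stdSimplex ℝ S) (s₀ s : S) :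
    (chainLaw P s₀).real {ω | ω 0 = s} = if s = s₀ then 1 else 0 := by
  have h : (chainLaw P s₀).map (frestrictLe (π := fun _ : ℕ => S) 0) =
      (Measure.dirac s₀).map (MeasurableEquiv.piUnique _).symm := by
    rw [chainLaw, Kernel.trajMeasure, Measure.map_comp _ _ (by fun_prop), Kernel.traj_map_frestrictLe,
      Kernel.partialTraj_self, Measure.id_comp]
  have h' : (chainLaw P s₀).map (fun ω => ω 0) = Measure.dirac s₀ := by
    have e : (fun ω : ℕ → S => ω 0) =
        (fun f : (i : Finset.Iic 0) → S => f ⟨0, by simp⟩) ∘ frestrictLe (π := fun _ : ℕ => S) 0 := rfl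
    rw [e, ← Measure.map_map (by fun_prop) (by fun_prop), h, Measure.map_map (by fun_prop) (by fun_prop)]
    exact Measure.map_id
  have e : {ω : ℕ → S | ω 0 = s} = (fun ω => ω 0) ⁻¹' {s} := rfl
  rw [e, ← map_measureReal_apply (by fun_prop) (MeasurableSet.singleton _), h', measureReal_def,
    Measure.dirac_apply' _ (MeasurableSet.singleton s)]
  by_cases hs : s = s₀ <;> simp [hs]

/-- The Markov property in product form, without division, so that it also holds for histories of
probability zero. -/
lemma chainLaw_real_history_inter (P : S → stdSimplex ℝ S) (s₀ : S) (s : ℕ → S) (n : ℕ) (s' : S) :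
    (chainLaw P s₀).real (history s n ∩ {ω | ω (n + 1) = s'}) =
      (chainLaw P s₀).real (history s n) * P (s n) s' := by
  have h := Kernel.map_frestrictLe_trajMeasure_compProd_eq_map_trajMeasure
    (X := fun _ : ℕ => S) (μ₀ := Measure.dirac s₀) (κ := fun n => (stepKernel P).comap
      (fun h : (i : Finset.Iic n) → S => h ⟨n, Finset.mem_Iic.2 le_rfl⟩) (by fun_prop)) (a := n)
  have h' := congrArg (fun m => m ({frestrictLe n s} ×ˢ {s'})) h
  beta_reduce at h'
  -- On a rectangle over a single history, the composition-product integral collapses to the kernel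
  -- at that history times its mass.
  rw [Measure.compProd_apply_prod (MeasurableSet.singleton _) (MeasurableSet.singleton _),
    lintegral_singleton, Measure.map_apply (by fun_prop) (MeasurableSet.singleton _),
    ← history_eq_preimage, Measure.map_apply (by fun_prop)
      ((MeasurableSet.singleton _).prod (MeasurableSet.singleton _))] at h'
  have e : (fun x : ℕ → S => (frestrictLe (π := fun _ : ℕ => S) n x, x (n + 1))) ⁻¹'
      ({frestrictLe n s} ×ˢ {s'}) = history s n ∩ {ω | ω (n + 1) = s'} := by
    rw [history_eq_preimage]; rfl
  rw [e] at h'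
  rw [measureReal_def, measureReal_def, chainLaw, ← h', ENNReal.toReal_mul, mul_comm,
    ← stepKernel_real_singleton]
  rfl

/-- A measure of a set is the sum over the fibres of a map to a finite type. -/
lemma sum_measureReal_inter_fiber {Ω T : Type*} [MeasurableSpace Ω] [Fintype T] [MeasurableSpace T]
    [MeasurableSingletonClass T] (M : Measure Ω) [IsFiniteMeasure M] {g : Ω → T}
    (hg : Measurable g) (B : Set Ω) : ∑ f, M.real (B ∩ g ⁻¹' {f}) = M.real B := by
  have := sum_measureReal_preimage_singleton (μ := M.restrict B) (Finset.univ) (f := g)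
    (fun y _ => hg (MeasurableSet.singleton y))
  simp only [Finset.coe_univ, Set.preimage_univ, measureReal_restrict_apply_univ] at this
  rw [← this]
  refine Finset.sum_congr rfl fun f _ => ?_
  rw [measureReal_restrict_apply (hg (MeasurableSet.singleton f)), Set.inter_comm]

/-- If an event has conditional probability `r` given each history up to time `n` in `A`,
then it has conditional probability `r` given `A`. -/
lemma measureReal_inter_eq_mul_of_history {M : Measure (ℕ → S)} [IsFiniteMeasure M]
    {A E : Set (ℕ → S)} {n : ℕ} {r : ℝ}
    (hA : ∀ ω ω', (∀ t ≤ n, ω' t = ω t) → ω ∈ A → ω' ∈ A)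
    (h : ∀ s ∈ A, M.real (history s n ∩ E) = M.real (history s n) * r) :
    M.real (A ∩ E) = M.real A * r := by
  have hg : Measurable (frestrictLe (π := fun _ : ℕ => S) n) := measurable_frestrictLe n
  rw [← sum_measureReal_inter_fiber M hg (A ∩ E), ← sum_measureReal_inter_fiber M hg A,
    Finset.sum_mul]
  refine Finset.sum_congr rfl fun f _ => ?_
  -- A fibre either misses `A` or is the history of some `s ∈ A`; in the latter case it lies inside
  -- `A`, which depends only on times up to `n`.
  rcases (A ∩ frestrictLe (π := fun _ : ℕ => S) n ⁻¹' {f}).eq_empty_or_nonempty with h0 | ⟨s, hs, hf⟩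
  · rw [h0, Set.inter_right_comm, h0]; simp
  · obtain rfl : frestrictLe n s = f := hf
    rw [← history_eq_preimage, Set.inter_right_comm,
      Set.inter_eq_right.2 (show history s n ⊆ A from fun ω hω => hA s ω hω hs), h s hs]

/-- A law on trajectories is determined by the probabilities of the histories. -/
lemma ext_of_history {M N : Measure (ℕ → S)} [IsFiniteMeasure M] [IsFiniteMeasure N]
    (h : ∀ s n, M.real (history s n) = N.real (history s n)) : M = N := by
  have hn (n : ℕ) : M.map (frestrictLe (π := fun _ : ℕ => S) n) =
      N.map (frestrictLe (π := fun _ : ℕ => S) n) := by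
    refine Measure.ext_of_singleton fun f => ?_
    rw [Measure.map_apply (by fun_prop) (MeasurableSet.singleton _),
      Measure.map_apply (by fun_prop) (MeasurableSet.singleton _)]
    rcases (frestrictLe (π := fun _ : ℕ => S) n ⁻¹' {f}).eq_empty_or_nonempty with h0 | ⟨s, hf⟩
    · simp [h0]
    · obtain rfl : frestrictLe n s = f := hf
      rw [← history_eq_preimage]
      exact (measureReal_eq_measureReal_iff (measure_ne_top _ _) (measure_ne_top _ _)).1 (h s n)
  -- Every finite set of times lies in an initial segment, so the laws of the initial segments fix
  -- all finite-dimensional laws.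
  refine IsProjectiveLimit.unique (P := fun I : Finset ℕ => N.map I.restrict) (fun I => ?_)
    (fun I => rfl)
  have hI : I ⊆ Finset.Iic (I.sup id) := fun i hi => Finset.mem_Iic.2 (Finset.le_sup (f := id) hi)
  have e : (I.restrict : (ℕ → S) → (I → S)) =
      Finset.restrict₂ (π := fun _ : ℕ => S) hI ∘ frestrictLe (π := fun _ : ℕ => S) (I.sup id) := rfl
  rw [e, ← Measure.map_map (by fun_prop) (by fun_prop), hn,
    Measure.map_map (by fun_prop) (by fun_prop)]
  rfl

lemma chainLaw_real_inter_mem {A : Set (ℕ → S)} {n : ℕ} (P : S → stdSimplex ℝ S) (s₀ : S)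
    (hA : ∀ ω ω', (∀ t ≤ n, ω' t = ω t) → ω ∈ A → ω' ∈ A) {s : S} (hs : ∀ ω ∈ A, ω n = s) (s' : S) :
    (chainLaw P s₀).real (A ∩ {ω | ω (n + 1) = s'}) = (chainLaw P s₀).real A * P s s' :=
  measureReal_inter_eq_mul_of_history hA fun ω hω => by
    rw [chainLaw_real_history_inter, hs ω hω]

/-- The characterization of the law of a Markov chain by its initial state and its transitions. -/
lemma eq_chainLaw {M : Measure (ℕ → S)} [IsFiniteMeasure M] {P : S → stdSimplex ℝ S} {s₀ : S}
    (h0 : ∀ s, M.real {ω | ω 0 = s} = (chainLaw P s₀).real {ω | ω 0 = s})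
    (h : ∀ s n, M.real (history s n ∩ {ω | ω (n + 1) = s (n + 1)}) =
      M.real (history s n) * P (s n) (s (n + 1))) : M = chainLaw P s₀ := by
  refine ext_of_history fun s n => ?_
  induction n with
  | zero =>
    have e : history s 0 = {ω | ω 0 = s 0} := by ext; simp [history]
    rw [e, h0]
  | succ n ih => rw [history_succ, h, ih, chainLaw_real_history_inter]

lemma nextProb_eq_div (M : Measure (ℕ → S)) (s : ℕ → S) (n : ℕ) (s' : S) :
    nextProb M s n s' =
      (M.real (history s n))⁻¹ * M.real (history s n ∩ {ω | ω (n + 1) = s'}) := by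
  rw [nextProb, measureReal_def, cond_apply (measurableSet_history s n), ENNReal.toReal_mul,
    ENNReal.toReal_inv]
  rfl

/-- Positive probability matters: conditioning on a null history yields the zero measure, not a row
of `P`. -/
lemma nextProb_chainLaw {P : S → stdSimplex ℝ S} {s₀ : S} {s : ℕ → S} {n : ℕ}
    (h : chainLaw P s₀ (history s n) ≠ 0) (s' : S) :
    nextProb (chainLaw P s₀) s n s' = P (s n) s' := by
  rw [nextProb_eq_div, chainLaw_real_history_inter, inv_mul_cancel_left₀]
  rwa [Ne, measureReal_eq_zero_iff]

/-- The probability of an event in terms of a finer description of the state at time `t`. -/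
lemma measureReal_inter_comp_eval {S Z : Type*} [Fintype Z] [MeasurableSpace Z]
    [DiscreteMeasurableSpace Z] [DecidableEq S] (M : Measure (ℕ → Z)) [IsFiniteMeasure M]
    (π : Z → S) (B : Set (ℕ → Z)) (t : ℕ) (s : S) :
    M.real (B ∩ {ω | π (ω t) = s}) = ∑ z with π z = s, M.real (B ∩ {ω | ω t = z}) := by
  rw [← sum_measureReal_inter_fiber M (measurable_pi_apply t) (B ∩ {ω | π (ω t) = s}),
    Finset.sum_filter]
  refine Finset.sum_congr rfl fun z _ => ?_
  split_ifs with h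
  · congr 1
    ext ω
    simp only [Set.mem_inter_iff, Set.mem_ofPred_eq, Set.mem_preimage, Set.mem_singleton_iff]
    grind
  · convert! measureReal_empty
    ext ω
    simp only [Set.mem_inter_iff, Set.mem_ofPred_eq, Set.mem_preimage, Set.mem_singleton_iff,
      Set.mem_empty_iff_false]
    grind

/-- The image of a Markov chain under a map that intertwines the transition functions. -/
lemma map_chainLaw {Z : Type*} [Fintype Z] [MeasurableSpace Z] [DiscreteMeasurableSpace Z]
    [DecidableEq S] (π : Z → S) {Q : Z → stdSimplex ℝ Z} {P : S → stdSimplex ℝ S}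
    (hQ : ∀ z s, ∑ z' with π z' = s, Q z z' = P (π z) s) (z₀ : Z) :
    (chainLaw Q z₀).map (fun ω t => π (ω t)) = chainLaw P (π z₀) := by
  classical
  have hπ := measurable_comp_path π
  have : IsProbabilityMeasure ((chainLaw Q z₀).map (fun ω t => π (ω t))) :=
    Measure.isProbabilityMeasure_map hπ.aemeasurable
  have hm (t : ℕ) (s : S) : MeasurableSet {ω : ℕ → S | ω t = s} :=
    (measurable_pi_apply (X := fun _ : ℕ => S) t) (MeasurableSet.singleton s)
  refine eq_chainLaw (fun s => ?_) (fun s n => ?_)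
  · rw [map_measureReal_apply hπ (hm _ _), chainLaw_real_zero]
    have := measureReal_inter_comp_eval (chainLaw Q z₀) π Set.univ 0 s
    simp only [Set.univ_inter, chainLaw_real_zero] at this
    refine this.trans ?_
    simp [eq_comm]
  · rw [map_measureReal_apply hπ ((measurableSet_history _ _).inter (hm _ _)),
      map_measureReal_apply hπ (measurableSet_history _ _)]
    -- The `S`-history is a union of `Z`-histories. Given any of these, the next projected state has
    -- law `P (s n)` by `hQ`.
    refine measureReal_inter_eq_mul_of_history (n := n) (fun ω ω' hω h t ht => ?_) fun ω hω => ?_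
    · simpa only [hω t ht] using h t ht
    · have hn : π (ω n) = s n := hω n le_rfl
      rw [← hn, ← hQ, Finset.mul_sum]
      refine (measureReal_inter_comp_eval _ π _ _ _).trans (Finset.sum_congr rfl fun z _ => ?_)
      rw [chainLaw_real_history_inter]

end Law

/-! ### Discounted occupation measures and the flow equation -/

section Occupation

variable {Z : Type*} [MeasurableSpace Z]

/-- The discounted occupation measure of the transitions of a process with law `M`. -/
noncomputable def occupation (γ : ℝ) (M : Measure (ℕ → Z)) (p : Z × Z) : ℝ :=
  (1 - γ) * ∑' t, γ ^ t * M.real ({ω | ω t = p.1} ∩ {ω | ω (t + 1) = p.2})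

lemma summable_discount {γ : ℝ} (hγ0 : 0 < γ) (hγ1 : γ < 1) {a : ℕ → ℝ} {C : ℝ}
    (ha : ∀ t, |a t| ≤ C) : Summable fun t => γ ^ t * a t := by
  refine Summable.of_norm_bounded ((summable_geometric_of_lt_one hγ0.le hγ1).mul_right C) fun t => ?_
  rw [Real.norm_eq_abs, abs_mul, abs_of_nonneg (pow_nonneg hγ0.le t)]
  exact mul_le_mul_of_nonneg_left (ha t) (pow_nonneg hγ0.le t)

lemma summable_discount_prob {γ : ℝ} (hγ0 : 0 < γ) (hγ1 : γ < 1) (M : Measure (ℕ → Z))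
    [IsProbabilityMeasure M] (A : ℕ → Set (ℕ → Z)) : Summable fun t => γ ^ t * M.real (A t) :=
  summable_discount hγ0 hγ1 (C := 1) fun t => by
    rw [abs_of_nonneg measureReal_nonneg]; exact measureReal_le_one

variable {γ : ℝ} {M : Measure (ℕ → Z)} [IsProbabilityMeasure M]

omit [IsProbabilityMeasure M] in
lemma occupation_nonneg (hγ0 : 0 < γ) (hγ1 : γ < 1) (p : Z × Z) : 0 ≤ occupation γ M p :=
  mul_nonneg (by linarith) (tsum_nonneg fun t => by positivity)

lemma sum_occupation (hγ0 : 0 < γ) (hγ1 : γ < 1) (F : Finset (Z × Z)) :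
    ∑ p ∈ F, occupation γ M p =
      (1 - γ) * ∑' t, γ ^ t * ∑ p ∈ F, M.real ({ω | ω t = p.1} ∩ {ω | ω (t + 1) = p.2}) := by
  simp only [occupation, ← Finset.mul_sum]
  rw [← Summable.tsum_finsetSum fun p _ => summable_discount_prob hγ0 hγ1 M _]
  simp only [Finset.mul_sum]

variable [Fintype Z] [DiscreteMeasurableSpace Z]

omit [IsProbabilityMeasure M] in
lemma sum_measureReal_inter_eval [IsFiniteMeasure M] (A : Set (ℕ → Z)) (t : ℕ) :
    ∑ z, M.real (A ∩ {ω | ω t = z}) = M.real A :=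
  sum_measureReal_inter_fiber M (measurable_pi_apply (X := fun _ : ℕ => Z) t) A

lemma sum_occupation_left (hγ0 : 0 < γ) (hγ1 : γ < 1) (z : Z) :
    ∑ z', occupation γ M (z, z') = (1 - γ) * ∑' t, γ ^ t * M.real {ω | ω t = z} := by
  have := sum_occupation (M := M) hγ0 hγ1 (Finset.univ.map (Function.Embedding.sectR z Z))
  simpa [sum_measureReal_inter_eval] using this

lemma sum_occupation_right (hγ0 : 0 < γ) (hγ1 : γ < 1) (z : Z) :
    ∑ z', occupation γ M (z', z) = (1 - γ) * ∑' t, γ ^ t * M.real {ω | ω (t + 1) = z} := by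
  have := sum_occupation (M := M) hγ0 hγ1 (Finset.univ.map (Function.Embedding.sectL Z z))
  simp only [Finset.sum_map, Function.Embedding.sectL_apply] at this
  rw [this]
  simp_rw [Set.inter_comm {ω : ℕ → Z | ω _ = _} {ω | ω (_ + 1) = z}, sum_measureReal_inter_eval]

/-- The incoming sum is the outgoing one shifted by one time step, hence the factor γ; the term at
time 0 is left over as the source. -/
lemma occupation_flow (hγ0 : 0 < γ) (hγ1 : γ < 1) (z : Z) :
    ∑ z', occupation γ M (z, z') =
      γ * ∑ z', occupation γ M (z', z) + (1 - γ) * M.real {ω | ω 0 = z} := by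
  rw [sum_occupation_left hγ0 hγ1, sum_occupation_right hγ0 hγ1,
    (summable_discount_prob hγ0 hγ1 M _).tsum_eq_zero_add]
  simp only [pow_succ', mul_assoc, tsum_mul_left]
  ring

lemma occupation_mem_stdSimplex (hγ0 : 0 < γ) (hγ1 : γ < 1) :
    occupation γ M ∈ stdSimplex ℝ (Z × Z) := by
  refine ⟨occupation_nonneg hγ0 hγ1, ?_⟩
  have h (t : ℕ) : ∑ z, M.real {ω | ω t = z} = 1 := by
    simpa using sum_measureReal_inter_eval (M := M) Set.univ t
  rw [Fintype.sum_prod_type]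
  simp only [sum_occupation_left hγ0 hγ1]
  rw [← Finset.mul_sum, ← Summable.tsum_finsetSum fun _ _ => summable_discount_prob hγ0 hγ1 M _]
  simp only [← Finset.mul_sum, h, mul_one, tsum_geometric_of_lt_one hγ0.le hγ1]
  exact mul_inv_cancel₀ (by linarith)

/-- A conditional transition probability that does not depend on time is inherited by the
occupation measure. -/
lemma sum_occupation_eq_mul (hγ0 : 0 < γ) (hγ1 : γ < 1) {z : Z} {F : Finset Z} {r : ℝ}
    (h : ∀ t, ∑ z' ∈ F, M.real ({ω | ω t = z} ∩ {ω | ω (t + 1) = z'}) = M.real {ω | ω t = z} * r) :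
    ∑ z' ∈ F, occupation γ M (z, z') = (∑ z', occupation γ M (z, z')) * r := by
  have := sum_occupation (M := M) hγ0 hγ1 (F.map (Function.Embedding.sectR z Z))
  simp only [Finset.sum_map, Function.Embedding.sectR_apply, h] at this
  rw [this, sum_occupation_left hγ0 hγ1]
  simp only [← mul_assoc, tsum_mul_right]

omit [MeasurableSpace Z] [DiscreteMeasurableSpace Z] in
/-- The flow equation determines a distribution with given transition function. -/
lemma eq_of_flow (hγ0 : 0 < γ) (hγ1 : γ < 1) {μ μ' : Z × Z → ℝ} {b : Z → ℝ}
    {Q : Z → stdSimplex ℝ Z}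
    (h : ∀ z, ∑ z', μ (z, z') = γ * ∑ z', μ (z', z) + b z)
    (h' : ∀ z, ∑ z', μ' (z, z') = γ * ∑ z', μ' (z', z) + b z)
    (hQ : ∀ z z', μ (z, z') = (∑ w, μ (z, w)) * Q z z')
    (hQ' : ∀ z z', μ' (z, z') = (∑ w, μ' (z, w)) * Q z z') : μ = μ' := by
  -- The difference of the first marginals solves d = γ d Q. As the rows of `Q` sum to one, ‖d‖₁ ≤ γ
  -- ‖d‖₁, which forces d = 0.
  set d : Z → ℝ := fun z => ∑ w, μ (z, w) - ∑ w, μ' (z, w) with hd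
  have hdz (z : Z) : d z = γ * ∑ z', d z' * Q z' z := by
    simp only [hd, sub_mul, ← hQ, ← hQ', Finset.sum_sub_distrib]
    rw [h, h']; ring
  have hle : ∑ z, |d z| ≤ γ * ∑ z, |d z| := by
    calc ∑ z, |d z| ≤ ∑ z, γ * ∑ z', |d z'| * Q z' z := by
          refine Finset.sum_le_sum fun z _ => ?_
          rw [hdz z, abs_mul, abs_of_pos hγ0]
          refine mul_le_mul_of_nonneg_left ((Finset.abs_sum_le_sum_abs _ _).trans_eq ?_) hγ0.le
          exact Finset.sum_congr rfl fun z' _ => by rw [abs_mul, abs_of_nonneg (show 0 ≤ Q z' z from (Q z').2.1 z)]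
      _ = γ * ∑ z, |d z| := by
          rw [← Finset.mul_sum, Finset.sum_comm]
          simp only [← Finset.mul_sum]
          congr 1
          refine Finset.sum_congr rfl fun z _ => ?_
          have h1 : ∑ z', Q z z' = 1 := (Q z).2.2
          rw [h1, mul_one]
  have h0 : 0 ≤ ∑ z, |d z| := Finset.sum_nonneg fun z _ => abs_nonneg _
  have h00 : ∑ z, |d z| = 0 := by nlinarith
  have hz (z : Z) : d z = 0 :=
    abs_eq_zero.1 ((Finset.sum_eq_zero_iff_of_nonneg fun z _ => abs_nonneg _).1 h00 z (Finset.mem_univ z))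
  funext ⟨z, z'⟩
  rw [hQ, hQ', sub_eq_zero.1 (hz z)]

end Occupation

/-! ### Expected discounted cost -/

section Cost

variable {X Y : Type*} [Fintype X] [MeasurableSpace X] [DiscreteMeasurableSpace X]
  [Fintype Y] [MeasurableSpace Y] [DiscreteMeasurableSpace Y] {γ : ℝ} {M : Measure (ℕ → X × Y)}
  [IsProbabilityMeasure M]

lemma exists_abs_le_of_fintype {Z : Type*} [Fintype Z] (c : Z → ℝ) : ∃ C, ∀ z, |c z| ≤ C :=
  ⟨∑ z, |c z|, fun z => Finset.single_le_sum (f := fun z => |c z|) (fun _ _ => abs_nonneg _)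
    (Finset.mem_univ z)⟩

lemma integrable_discountedCost (hγ0 : 0 < γ) (hγ1 : γ < 1) (c : X × Y → ℝ) :
    Integrable (discountedCost γ c) M := by
  obtain ⟨C, hC⟩ := exists_abs_le_of_fintype c
  have hs (ω : ℕ → X × Y) := summable_discount hγ0 hγ1 (a := fun t => c (ω t)) fun t => hC (ω t)
  have hmeas : Measurable (discountedCost γ c) := by
    refine measurable_of_tendsto_metrizable (f := fun n ω => ∑ t ∈ Finset.range n, γ ^ t * c (ω t))
      (fun n => ?_) (tendsto_pi_nhds.2 fun ω => (hs ω).hasSum.tendsto_sum_nat)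
    refine Finset.measurable_sum _ fun t _ => Measurable.const_mul ?_ _
    exact (Measurable.of_discrete (f := c)).comp (measurable_pi_apply t)
  refine Integrable.of_bound hmeas.aestronglyMeasurable ((1 - γ)⁻¹ * C) (ae_of_all _ fun ω => ?_)
  rw [← tsum_geometric_of_lt_one hγ0.le hγ1, ← tsum_mul_right]
  refine tsum_of_norm_bounded ((summable_geometric_of_lt_one hγ0.le hγ1).mul_right C).hasSum fun t => ?_
  rw [Real.norm_eq_abs, abs_mul, abs_of_nonneg (pow_nonneg hγ0.le t)]
  exact mul_le_mul_of_nonneg_left (hC _) (pow_nonneg hγ0.le t)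

lemma integral_eval_eq_sum (c : X × Y → ℝ) (t : ℕ) :
    ∫ ω, c (ω t) ∂M = ∑ z, M.real {ω | ω t = z} * c z := by
  have hm : Measurable fun ω : ℕ → X × Y => ω t := measurable_pi_apply t
  have : IsProbabilityMeasure (M.map fun ω => ω t) := Measure.isProbabilityMeasure_map hm.aemeasurable
  rw [← integral_map (φ := fun ω : ℕ → X × Y => ω t) (f := c) hm.aemeasurable
    (Measurable.of_discrete (f := c)).aestronglyMeasurable, integral_fintype Integrable.of_finite]
  refine Finset.sum_congr rfl fun z _ => ?_
  rw [map_measureReal_apply hm (MeasurableSet.singleton z), smul_eq_mul]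
  rfl

/-- The expected discounted cost is linear in the occupation measure. -/
lemma integral_discountedCost (hγ0 : 0 < γ) (hγ1 : γ < 1) (c : X × Y → ℝ) :
    ∫ ω, discountedCost γ c ω ∂M = 1 / (1 - γ) * lpCost c (occupation γ M) := by
  obtain ⟨C, hC⟩ := exists_abs_le_of_fintype c
  have hb (t : ℕ) (ω : ℕ → X × Y) : ‖γ ^ t * c (ω t)‖ ≤ γ ^ t * C := by
    rw [Real.norm_eq_abs, abs_mul, abs_of_nonneg (pow_nonneg hγ0.le t)]
    exact mul_le_mul_of_nonneg_left (hC _) (pow_nonneg hγ0.le t)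
  have hint (t : ℕ) : Integrable (fun ω : ℕ → X × Y => γ ^ t * c (ω t)) M := by
    refine Integrable.of_bound (Measurable.aestronglyMeasurable (Measurable.const_mul ?_ _)) _
      (ae_of_all _ (hb t))
    exact (Measurable.of_discrete (f := c)).comp (measurable_pi_apply t)
  have hsum : Summable fun t => ∫ ω, ‖γ ^ t * c (ω t)‖ ∂M := by
    refine Summable.of_nonneg_of_le (fun t => integral_nonneg fun ω => norm_nonneg _) (fun t => ?_)
      ((summable_geometric_of_lt_one hγ0.le hγ1).mul_right C)
    refine (integral_mono (hint t).norm (integrable_const _) (hb t)).trans_eq ?_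
    simp
  have hz (z : X × Y) : Summable fun t => γ ^ t * (M.real {ω | ω t = z} * c z) := by
    simpa only [mul_assoc] using (summable_discount_prob hγ0 hγ1 M _).mul_right (c z)
  unfold discountedCost
  -- The geometric bound γᵗ C permits exchanging the sum over time with the expectation.
  rw [← integral_tsum_of_summable_integral_norm hint hsum]
  simp only [integral_const_mul, integral_eval_eq_sum, lpCost, ← Finset.sum_mul,
    sum_occupation_left hγ0 hγ1]
  simp only [mul_assoc, ← Finset.mul_sum, ← tsum_mul_right]
  rw [← Summable.tsum_finsetSum fun z _ => hz z, ← mul_assoc, one_div,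
    inv_mul_cancel₀ (by linarith), one_mul]
  simp only [Finset.mul_sum]

end Cost

/-! ### Conditional laws of a component -/

section Projection

variable {S Z : Type*} [Fintype S] [MeasurableSpace S] [DiscreteMeasurableSpace S] [DecidableEq S]
  [Fintype Z] [MeasurableSpace Z] [DiscreteMeasurableSpace Z]

omit [DecidableEq S] [Fintype Z] in
lemma measure_history_comp_ne_zero {M : Measure (ℕ → Z)} {N : Measure (ℕ → S)} {π : Z → S}
    (hM : M.map (fun ω t => π (ω t)) = N) {s : ℕ → Z} {n : ℕ} (h : M (history s n) ≠ 0) :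
    N (history (fun t => π (s t)) n) ≠ 0 := by
  rw [← hM, Measure.map_apply (measurable_comp_path π) (measurableSet_history _ _)]
  exact fun h0 => h (measure_mono_null (fun ω hω t ht => congrArg π (hω t ht)) h0)

/-- If the conditional law of the next state of a component, given the past of the whole process,
is that of a Markov chain, then the occupation measure is coherent with its transitions. -/
lemma sum_occupation_of_nextProb {γ : ℝ} (hγ0 : 0 < γ) (hγ1 : γ < 1) {M : Measure (ℕ → Z)}
    [IsProbabilityMeasure M] {π : Z → S} {P : S → stdSimplex ℝ S} {s₀ : S}
    (hM : M.map (fun ω t => π (ω t)) = chainLaw P s₀)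
    (h : ∀ s n, M (history s n) ≠ 0 → ∀ s', ∑ z' with π z' = s', nextProb M s n z' =
      nextProb (chainLaw P s₀) (fun t => π (s t)) n s') (z : Z) (s' : S) :
    ∑ z' with π z' = s', occupation γ M (z, z') =
      (∑ z', occupation γ M (z, z')) * P (π z) s' := by
  refine sum_occupation_eq_mul hγ0 hγ1 fun t => ?_
  rw [← measureReal_inter_comp_eval]
  refine measureReal_inter_eq_mul_of_history (n := t) (fun ω ω' hω hz => ?_) fun s hs => ?_
  · exact (hω t le_rfl).trans hz
  · obtain rfl : s t = z := hs
    -- The hypothesis says nothing about null histories, but there both sides vanish.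
    by_cases h0 : M (history s t) = 0
    · have h0' : M.real (history s t) = 0 := (measureReal_eq_zero_iff).2 h0
      rw [h0', zero_mul]
      exact (measureReal_eq_zero_iff).2 (measure_mono_null Set.inter_subset_left h0)
    · have h1 := h s t h0 s'
      rw [nextProb_chainLaw (measure_history_comp_ne_zero hM h0)] at h1
      simp only [nextProb_eq_div, ← Finset.mul_sum, ← measureReal_inter_comp_eval] at h1
      rw [← h1, mul_inv_cancel_left₀]
      rwa [Ne, measureReal_eq_zero_iff]

/-- A Markov chain whose transitions project to those of a second chain has the conditional
next-step probabilities of the latter. -/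
lemma sum_nextProb_chainLaw {Q : Z → stdSimplex ℝ Z} {P : S → stdSimplex ℝ S} {π : Z → S}
    (hQ : ∀ z s, ∑ z' with π z' = s, Q z z' = P (π z) s) {z₀ : Z} {s : ℕ → Z} {n : ℕ}
    (h : chainLaw Q z₀ (history s n) ≠ 0) (s' : S) :
    ∑ z' with π z' = s', nextProb (chainLaw Q z₀) s n z' =
      nextProb (chainLaw P (π z₀)) (fun t => π (s t)) n s' := by
  rw [nextProb_chainLaw (measure_history_comp_ne_zero (map_chainLaw π hQ z₀) h), ← hQ]
  exact Finset.sum_congr rfl fun z' _ => nextProb_chainLaw h z'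

end Projection

/-! ### Joint transition functions with prescribed marginals -/

section Products

variable {X Y : Type*} [Fintype X] [Fintype Y]

lemma sum_filter_fst_eq [DecidableEq X] (f : X × Y → ℝ) (x : X) :
    ∑ z with z.1 = x, f z = ∑ y, f (x, y) := by
  rw [Finset.sum_filter, Fintype.sum_prod_type, Finset.sum_comm]
  simp

lemma sum_filter_snd_eq [DecidableEq Y] (f : X × Y → ℝ) (y : Y) :
    ∑ z with z.2 = y, f z = ∑ x, f (x, y) := by
  rw [Finset.sum_filter, Fintype.sum_prod_type]
  simp

/-- The transition function of two chains that move independently. -/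
noncomputable def prodStep (PX : X → stdSimplex ℝ X) (PY : Y → stdSimplex ℝ Y) (z : X × Y) :
    stdSimplex ℝ (X × Y) :=
  ⟨fun z' => PX z.1 z'.1 * PY z.2 z'.2,
    fun z' => mul_nonneg ((PX z.1).2.1 z'.1) ((PY z.2).2.1 z'.2), by
      have h1 : ∑ x, PX z.1 x = 1 := (PX z.1).2.2
      have h2 : ∑ y, PY z.2 y = 1 := (PY z.2).2.2
      rw [Fintype.sum_prod_type]
      simp only [← Finset.mul_sum, h2, mul_one, h1]⟩

/-- The transition function obtained by disintegrating a distribution on pairs of states, with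
independent moves from the states of mass zero. -/
noncomputable def disintegration (PX : X → stdSimplex ℝ X) (PY : Y → stdSimplex ℝ Y)
    (μ : (X × Y) × (X × Y) → ℝ) (hμ : ∀ p, 0 ≤ μ p) (z : X × Y) : stdSimplex ℝ (X × Y) :=
  open Classical in
  if h : ∑ w, μ (z, w) = 0 then prodStep PX PY z else
    ⟨fun z' => μ (z, z') / ∑ w, μ (z, w),
      fun z' => div_nonneg (hμ _) (Finset.sum_nonneg fun w _ => hμ _), by
        rw [← Finset.sum_div, div_self h]⟩

variable {PX : X → stdSimplex ℝ X} {PY : Y → stdSimplex ℝ Y}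
  {μ : (X × Y) × (X × Y) → ℝ} (hμ : ∀ p, 0 ≤ μ p)

/-- At a state of zero mass nonnegativity makes the whole row of `μ` vanish, so the choice of
transition there is immaterial. -/
lemma eq_mul_disintegration (z z' : X × Y) :
    μ (z, z') = (∑ w, μ (z, w)) * disintegration PX PY μ hμ z z' := by
  unfold disintegration
  split_ifs with h
  · rw [h, zero_mul]
    exact (Finset.sum_eq_zero_iff_of_nonneg fun w _ => hμ _).1 h z' (Finset.mem_univ _)
  · exact (mul_div_cancel₀ _ h).symm

lemma sum_prodStep_fst (z : X × Y) (x : X) : ∑ y, prodStep PX PY z (x, y) = PX z.1 x := by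
  have h2 : ∑ y, PY z.2 y = 1 := (PY z.2).2.2
  change ∑ y, PX z.1 x * PY z.2 y = _
  rw [← Finset.mul_sum, h2, mul_one]

lemma sum_prodStep_snd (z : X × Y) (y : Y) : ∑ x, prodStep PX PY z (x, y) = PY z.2 y := by
  have h1 : ∑ x, PX z.1 x = 1 := (PX z.1).2.2
  change ∑ x, PX z.1 x * PY z.2 y = _
  rw [← Finset.sum_mul, h1, one_mul]

lemma sum_disintegration_fst (h : μ ∈ coherentX (Y := Y) PX) (z : X × Y) (x : X) :
    ∑ y, disintegration PX PY μ hμ z (x, y) = PX z.1 x := by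
  unfold disintegration
  split_ifs with h0
  · exact sum_prodStep_fst z x
  · change ∑ y, μ (z, (x, y)) / ∑ w, μ (z, w) = _
    rw [← Finset.sum_div, h.2 z.1 z.2 x, mul_div_cancel_left₀ _ h0]

lemma sum_disintegration_snd (h : μ ∈ coherentY (X := X) PY) (z : X × Y) (y : Y) :
    ∑ x, disintegration PX PY μ hμ z (x, y) = PY z.2 y := by
  unfold disintegration
  split_ifs with h0
  · exact sum_prodStep_snd z y
  · change ∑ x, μ (z, (x, y)) / ∑ w, μ (z, w) = _
    rw [← Finset.sum_div, h.2 z.1 z.2 y, mul_div_cancel_left₀ _ h0]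

end Products

/-! ### Bicausal couplings versus feasible points -/

section Correspondence

variable {X Y : Type*} [Fintype X] [MeasurableSpace X] [DiscreteMeasurableSpace X]
  [Fintype Y] [MeasurableSpace Y] [DiscreteMeasurableSpace Y]
  {PX : X → stdSimplex ℝ X} {PY : Y → stdSimplex ℝ Y} {x₀ : X} {y₀ : Y} {γ : ℝ}

/-- Both coordinate projections intertwine `Q` with the marginal transition functions, which yields
the marginals and bicausality at once. -/
lemma chainLaw_mem_bicausalCouplings {Q : X × Y → stdSimplex ℝ (X × Y)}
    (hX : ∀ z x, ∑ y, Q z (x, y) = PX z.1 x) (hY : ∀ z y, ∑ x, Q z (x, y) = PY z.2 y) :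
    chainLaw Q (x₀, y₀) ∈ bicausalCouplings PX PY x₀ y₀ := by
  have := Classical.decEq X
  have := Classical.decEq Y
  have hX' (z : X × Y) (x : X) : ∑ z' with z'.1 = x, Q z z' = PX z.1 x := by
    rw [sum_filter_fst_eq, hX]
  have hY' (z : X × Y) (y : Y) : ∑ z' with z'.2 = y, Q z z' = PY z.2 y := by
    rw [sum_filter_snd_eq, hY]
  refine ⟨inferInstance, ⟨map_chainLaw Prod.fst hX' _, map_chainLaw Prod.snd hY' _⟩,
    fun n x y h => ⟨fun x' => ?_, fun y' => ?_⟩⟩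
  · rw [← sum_filter_fst_eq]
    exact sum_nextProb_chainLaw (π := Prod.fst) hX' h x'
  · rw [← sum_filter_snd_eq]
    exact sum_nextProb_chainLaw (π := Prod.snd) hY' h y'

open Classical in
-- Both marginals at time 0 are point masses. A pair with a wrong coordinate lies in a null event of
-- one of them, so all mass sits at the initial pair.
lemma measureReal_zero_of_isCoupling {M : Measure (ℕ → X × Y)} [IsProbabilityMeasure M]
    (h : IsCoupling (chainLaw PX x₀) (chainLaw PY y₀) M) (z : X × Y) :
    M.real {ω | ω 0 = z} = if z = (x₀, y₀) then 1 else 0 := by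
  have h1 := fun s => chainLaw_real_zero PX x₀ s
  have h2 := fun s => chainLaw_real_zero PY y₀ s
  have hmX (s : X) : MeasurableSet {ω : ℕ → X | ω 0 = s} :=
    (measurable_pi_apply (X := fun _ : ℕ => X) 0) (MeasurableSet.singleton s)
  have hmY (s : Y) : MeasurableSet {ω : ℕ → Y | ω 0 = s} :=
    (measurable_pi_apply (X := fun _ : ℕ => Y) 0) (MeasurableSet.singleton s)
  simp only [← h.1, map_measureReal_apply (measurable_comp_path (Prod.fst (α := X) (β := Y))) (hmX _)] at h1
  simp only [← h.2, map_measureReal_apply (measurable_comp_path (Prod.snd (α := X) (β := Y))) (hmY _)] at h2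
  have hne (z : X × Y) (hz : z ≠ (x₀, y₀)) : M.real {ω | ω 0 = z} = 0 := by
    refine le_antisymm ?_ measureReal_nonneg
    by_cases hx : z.1 = x₀
    · have hy : z.2 ≠ y₀ := fun hy => hz (Prod.ext hx hy)
      refine le_of_le_of_eq ?_ ((h2 z.2).trans (if_neg hy))
      exact measureReal_mono fun ω hω => congrArg Prod.snd hω
    · refine le_of_le_of_eq ?_ ((h1 z.1).trans (if_neg hx))
      exact measureReal_mono fun ω hω => congrArg Prod.fst hω
  split_ifs with hz
  · have := sum_measureReal_inter_eval (M := M) Set.univ 0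
    simp only [Set.univ_inter, probReal_univ] at this
    rw [hz, ← this]
    exact (Finset.sum_eq_single _ (fun z _ => hne z) (fun h => absurd (Finset.mem_univ _) h)).symm
  · exact hne z hz

lemma occupation_mem {M : Measure (ℕ → X × Y)} (hγ0 : 0 < γ) (hγ1 : γ < 1)
    (hM : M ∈ bicausalCouplings PX PY x₀ y₀) :
    occupation γ M ∈ flowSet γ x₀ y₀ ∩ coherentX PX ∩ coherentY PY := by
  have := Classical.decEq X
  have := Classical.decEq Y
  obtain ⟨_, hC, hB⟩ := hM
  have hs : occupation γ M ∈ stdSimplex ℝ _ := occupation_mem_stdSimplex hγ0 hγ1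
  refine ⟨⟨⟨hs, fun z => ?_⟩, hs, fun x y x' => ?_⟩, hs, fun x y y' => ?_⟩
  · rw [occupation_flow hγ0 hγ1, measureReal_zero_of_isCoupling hC]
  · rw [← sum_filter_fst_eq fun z' => occupation γ M ((x, y), z')]
    refine sum_occupation_of_nextProb hγ0 hγ1 (π := Prod.fst) hC.1 (fun s n h s' => ?_) (x, y) x'
    rw [sum_filter_fst_eq]
    exact (hB n (fun t => (s t).1) (fun t => (s t).2) h).1 s'
  · rw [← sum_filter_snd_eq fun z' => occupation γ M ((x, y), z')]
    refine sum_occupation_of_nextProb hγ0 hγ1 (π := Prod.snd) hC.2 (fun s n h s' => ?_) (x, y) y'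
    rw [sum_filter_snd_eq]
    exact (hB n (fun t => (s t).1) (fun t => (s t).2) h).2 s'

/-- Every feasible point of the linear program is the occupation measure of a bicausal coupling. -/
lemma exists_occupation_eq (hγ0 : 0 < γ) (hγ1 : γ < 1) {μ : (X × Y) × (X × Y) → ℝ}
    (h : μ ∈ flowSet γ x₀ y₀ ∩ coherentX PX ∩ coherentY PY) :
    ∃ M ∈ bicausalCouplings PX PY x₀ y₀, occupation γ M = μ := by
  obtain ⟨⟨hF, hX⟩, hY⟩ := h
  have hμ := hF.1.1
  have hM : chainLaw (disintegration PX PY μ hμ) (x₀, y₀) ∈ bicausalCouplings PX PY x₀ y₀ :=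
    chainLaw_mem_bicausalCouplings (sum_disintegration_fst hμ hX) (sum_disintegration_snd hμ hY)
  refine ⟨_, hM, eq_of_flow hγ0 hγ1 (occupation_mem hγ0 hγ1 hM).1.1.2 hF.2 (fun z z' => ?_)
    (eq_mul_disintegration (PX := PX) (PY := PY) hμ)⟩
  -- What remains is that the occupation measure of the constructed chain also has transition
  -- function `disintegration`; this is its Markov property given the current state alone.
  rw [← sum_occupation_eq_mul hγ0 hγ1 (F := {z'}), Finset.sum_singleton]
  intro t
  rw [Finset.sum_singleton]
  exact chainLaw_real_inter_mem _ _ (fun ω ω' hω hz => (hω t le_rfl).trans hz) (fun ω hω => hω) _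

end Correspondence

/-! ### Compactness and equality of the two values -/

lemma isCompact_feasible {X Y : Type*} [Fintype X] [Fintype Y] (γ : ℝ) (PX : X → stdSimplex ℝ X)
    (PY : Y → stdSimplex ℝ Y) (x₀ : X) (y₀ : Y) :
    IsCompact (flowSet γ x₀ y₀ ∩ coherentX PX ∩ coherentY PY) := by
  refine (isCompact_stdSimplex ℝ ((X × Y) × (X × Y))).of_isClosed_subset ?_ fun μ h => h.1.1.1
  have hs := isClosed_stdSimplex ℝ ((X × Y) × (X × Y))
  simp only [flowSet, coherentX, coherentY, Set.ofPred_and, Set.ofPred_forall]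
  refine ((hs.inter (isClosed_iInter fun _ => ?_)).inter (hs.inter (isClosed_iInter fun _ =>
    isClosed_iInter fun _ => isClosed_iInter fun _ => ?_))).inter (hs.inter (isClosed_iInter fun _ =>
    isClosed_iInter fun _ => isClosed_iInter fun _ => ?_))
  all_goals exact isClosed_eq (by fun_prop) (by fun_prop)

open scoped Pointwise in
lemma otDist_eq_sInf_lpCost {X Y : Type*}
    [Fintype X] [MeasurableSpace X] [DiscreteMeasurableSpace X]
    [Fintype Y] [MeasurableSpace Y] [DiscreteMeasurableSpace Y]
    (PX : X → stdSimplex ℝ X) (PY : Y → stdSimplex ℝ Y) (x₀ : X) (y₀ : Y)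
    (c : X × Y → ℝ) {γ : ℝ} (hγ0 : 0 < γ) (hγ1 : γ < 1) :
    otDist γ PX PY c x₀ y₀ =
      1 / (1 - γ) * sInf (lpCost c '' (flowSet γ x₀ y₀ ∩ coherentX PX ∩ coherentY PY)) := by
  -- The correspondence makes the sets of attained values equal, up to scaling, before any infimum
  -- is taken.
  have hset : (fun M => ∫ ω, discountedCost γ c ω ∂M) '' bicausalCouplings PX PY x₀ y₀ =
      (1 / (1 - γ)) • (lpCost c '' (flowSet γ x₀ y₀ ∩ coherentX PX ∩ coherentY PY)) := by
    ext r
    simp only [Set.mem_image, Set.mem_smul_set, exists_exists_and_eq_and, smul_eq_mul]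
    constructor
    · rintro ⟨M, hM, rfl⟩
      have := hM.1
      exact ⟨_, occupation_mem hγ0 hγ1 hM, (integral_discountedCost hγ0 hγ1 c).symm⟩
    · rintro ⟨μ, hμ, rfl⟩
      obtain ⟨M, hM, rfl⟩ := exists_occupation_eq hγ0 hγ1 hμ
      have := hM.1
      exact ⟨M, hM, integral_discountedCost hγ0 hγ1 c⟩
  rw [otDist, hset, Real.sInf_smul_of_nonneg (by rw [one_div, inv_nonneg]; linarith), smul_eq_mul]

end MarkovOT

theorem theorem1 {X Y : Type*}
    [Fintype X] [MeasurableSpace X] [DiscreteMeasurableSpace X]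
    [Fintype Y] [MeasurableSpace Y] [DiscreteMeasurableSpace Y]
    (PX : X → stdSimplex ℝ X) (PY : Y → stdSimplex ℝ Y) (x₀ : X) (y₀ : Y)
    (c : X × Y → ℝ) (hc : ∀ z, 0 ≤ c z) (γ : ℝ) (hγ0 : 0 < γ) (hγ1 : γ < 1) :
    -- the distance is the infimum of finite integrals over a non-empty set of couplings
    (bicausalCouplings PX PY x₀ y₀).Nonempty ∧
    (∀ M ∈ bicausalCouplings PX PY x₀ y₀, Integrable (discountedCost γ c) M) ∧
    -- the linear program attains its infimum
    (∃ μ ∈ flowSet γ x₀ y₀ ∩ coherentX PX ∩ coherentY PY,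
      IsMinOn (lpCost c) (flowSet γ x₀ y₀ ∩ coherentX PX ∩ coherentY PY) μ) ∧
    -- the distance is its value up to the factor `1 / (1 - γ)`
    otDist γ PX PY c x₀ y₀ =
      1 / (1 - γ) * sInf (lpCost c '' (flowSet γ x₀ y₀ ∩ coherentX PX ∩ coherentY PY)) := by
  have hne : (bicausalCouplings PX PY x₀ y₀).Nonempty :=
    ⟨_, chainLaw_mem_bicausalCouplings (Q := prodStep PX PY) sum_prodStep_fst sum_prodStep_snd⟩
  refine ⟨hne, fun M hM => ?_, ?_, ?_⟩
  · have := hM.1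
    exact integrable_discountedCost hγ0 hγ1 c
  · obtain ⟨M, hM⟩ := hne
    refine (isCompact_feasible γ PX PY x₀ y₀).exists_isMinOn ⟨_, occupation_mem hγ0 hγ1 hM⟩
      (Continuous.continuousOn ?_)
    unfold lpCost
    fun_prop
  · exact otDist_eq_sInf_lpCost PX PY x₀ y₀ c hγ0 hγ1
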